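/- Let $\Xi$ be a finite connected oriented graph with vertex set $V$, edge set $E$ and endpoint maps $d_0,d_1\colon E\to V$ (loops and multiple edges allowed). A graph of profinite groups $(\mathcal G,\Xi)$ consists of profinite groups $\mathcal G(v)$ $(v\in V)$ and $\mathcal G(e)$ $(e\in E)$ and continuous injective homomorphisms $\partial_i\colon\mathcal G(e)\to\mathcal G(d_i(e))$ for $e\in E$, $i=0,1$. Let $\Theta$ be a spanning tree of $\Xi$. The profinite fundamental group is $\Pi_1(\mathcal G,\Xi,\Theta)=W/N$, where $$W=\coprod_{v\in V}\mathcal G(v)\ \amalg\ F(T)$$ is the free profinite product of the vertex groups and of the free profinite group $F(T)$ on the set of stable letters $T=\{t_e: e\in E\}$, and $N$ is the smallest closed normal subgroup of $W$ containing $t_e$ for all $e\in E(\Theta)$ and $\partial_1(g)\,t_e^{-1}\,\partial_0(g)^{-1}\,t_e$ for all $e\in E$, $g\in\mathcal G(e)$. Let $G$ be a profinite group, identified with $\Pi_1(\mathcal G,\Xi,\Theta)$ by an isomorphism of profinite groups, and write $G(v)\le G$ for the image of $\mathcal G(v)$. A closed subgroup $H\le G$ is accessible within $G$ via $(\mathcal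 G,\Xi,\Theta)$ if $H=G(v)$ for some $v\in V$, all edge groups $\mathcal G(e)$ are finite, and all vertex groups $\mathcal G(u)$ are strongly complete, i.e. all their normal subgroups of finite index are open. Let $R$ be a nonzero profinite ring (associative with $1$, not necessarily commutative) and let $R[[G]]=\varprojlim_U R[G/U]$, with $U$ running over the open normal subgroups of $G$, be the completed group algebra with its inverse limit topology. **Proposition.** Let $H$ be accessible within $G$ via $(\mathcal G,\Xi,\Theta)$. Then for every vertex $w\in V$ there is a continuous right derivation $f\colon G\to R[[G]]$, i.e. a continuous map with $f(gh)=f(g)h+f(h)$ for all $g,h\in G$, such that $$G(w)\cap\operatorname{Ker}(f)=G(w)\cap H,\qquad\text{where } \operatorname{Ker}(f)=\{g\in G: f(g)=0\}.$$ -/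

import Mathlib

open CategoryTheory

universe u v x

noncomputable section

/-! ### Finite oriented graphs and spanning trees -/

/-- A finite connected oriented graph with vertex set `V`, edge set `E` and endpoint maps
`d₀, d₁ : E → V`; loops and multiple edges are allowed. -/
structure FiniteGraph (V : Type v) (E : Type x) where
  /-- The initial vertex of an edge. -/
  d₀ : E → V
  /-- The terminal vertex of an edge. -/
  d₁ : E → V
  finite_vertices : Finite V
  finite_edges : Finite E
  nonempty : Nonempty V
  connected : ∀ a b : V, Relation.EqvGen (fun p q => ∃ e : E, d₀ e = p ∧ d₁ e = q) a b

namespace FiniteGraph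

variable {V : Type v} {E : Type x} (Ξ : FiniteGraph V E)

/-- The vertices `a` and `b` are joined by a path all of whose edges lie in `S`
(edges may be traversed in both directions). -/
def Joined (S : Set E) (a b : V) : Prop :=
  Relation.EqvGen (fun p q => ∃ e ∈ S, Ξ.d₀ e = p ∧ Ξ.d₁ e = q) a b

/-- The subgraph with all vertices and with edge set `Θ` is a tree: it is connected, and it has
no circuits, i.e. no edge of `Θ` has its endpoints joined by the remaining edges of `Θ`. -/
structure IsSpanningTree (Θ : Set E) : Prop where
  connected : ∀ a b : V, Ξ.Joined Θ a b
  acyclic : ∀ e ∈ Θ, ¬ Ξ.Joined (Θ \ {e}) (Ξ.d₀ e) (Ξ.d₁ e)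

end FiniteGraph

/-! ### Completions and free profinite products -/

/-- The completion of an abstract group `A` with respect to a set `𝒩` of normal subgroups of
finite index: the inverse limit of the finite groups `A ⧸ N`, `N ∈ 𝒩`. -/
def relCompletion (A : Type u) [Group A] (𝒩 : Set (FiniteIndexNormalSubgroup A)) :
    ProfiniteGrp.{u} :=
  ProfiniteGrp.limit
    ((Subtype.mono_coe (· ∈ 𝒩)).functor ⋙ ProfiniteGrp.ProfiniteCompletion.diagram (GrpCat.of A))

/-- The canonical homomorphism of a group into its completion. -/
def relCompletion.of (A : Type u) [Group A] (𝒩 : Set (FiniteIndexNormalSubgroup A)) :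
    A →* relCompletion A 𝒩 where
  toFun a := ⟨fun _ => QuotientGroup.mk a, fun _ _ _ => rfl⟩
  map_one' := rfl
  map_mul' _ _ := rfl

/-- The free profinite product `∐ i, A i` of a family of profinite groups: the completion of the
abstract free product with respect to the normal subgroups of finite index which meet every
factor in an open subgroup. -/
def FreeProfiniteProduct {ι : Type v} (A : ι → ProfiniteGrp.{u}) : ProfiniteGrp.{max v u} :=
  relCompletion (Monoid.CoprodI fun i => A i)
    {N | ∀ i, IsOpen ((N.toSubgroup.comap (Monoid.CoprodI.of (i := i))) : Set (A i))}

/-- The canonical homomorphism of a factor into the free profinite product. -/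
def FreeProfiniteProduct.of {ι : Type v} (A : ι → ProfiniteGrp.{u}) (i : ι) :
    A i →* FreeProfiniteProduct A :=
  (relCompletion.of (Monoid.CoprodI fun i => A i) _).comp
    (Monoid.CoprodI.of (M := fun j => A j) (i := i))

/-- The free profinite product `A ⨿ B` of two profinite groups. -/
def BinaryFreeProfiniteProduct (A : ProfiniteGrp.{u}) (B : ProfiniteGrp.{v}) :
    ProfiniteGrp.{max u v} :=
  relCompletion (Monoid.Coprod A B)
    {N | IsOpen ((N.toSubgroup.comap Monoid.Coprod.inl) : Set A) ∧
      IsOpen ((N.toSubgroup.comap Monoid.Coprod.inr) : Set B)}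

/-- The canonical homomorphism `A → A ⨿ B`. -/
def BinaryFreeProfiniteProduct.inl (A : ProfiniteGrp.{u}) (B : ProfiniteGrp.{v}) :
    A →* BinaryFreeProfiniteProduct A B :=
  (relCompletion.of _ _).comp Monoid.Coprod.inl

/-- The canonical homomorphism `B → A ⨿ B`. -/
def BinaryFreeProfiniteProduct.inr (A : ProfiniteGrp.{u}) (B : ProfiniteGrp.{v}) :
    B →* BinaryFreeProfiniteProduct A B :=
  (relCompletion.of _ _).comp Monoid.Coprod.inr

/-- The free profinite group on a finite set `T`: the profinite completion of the free group. -/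
def FreeProfiniteGroup (T : Type x) : ProfiniteGrp.{x} :=
  ProfiniteGrp.ProfiniteCompletion.completion (GrpCat.of (FreeGroup T))

/-- The free generators of the free profinite group. -/
def FreeProfiniteGroup.of {T : Type x} (t : T) : FreeProfiniteGroup T :=
  ProfiniteGrp.ProfiniteCompletion.etaFn (GrpCat.of (FreeGroup T)) (FreeGroup.of t)

/-! ### Graphs of profinite groups and their profinite fundamental groups -/

/-- A graph of profinite groups over the finite connected graph `Ξ`: profinite vertex and edge
groups, with continuous injective homomorphisms from every edge group to the groups of the two
endpoints of the edge. -/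
structure GraphOfProfiniteGroups {V : Type v} {E : Type x} (Ξ : FiniteGraph V E) where
  /-- The vertex groups. -/
  vert : V → ProfiniteGrp.{u}
  /-- The edge groups. -/
  edge : E → ProfiniteGrp.{u}
  /-- The edge inclusions at the initial vertices. -/
  bdry₀ : ∀ e : E, edge e →ₜ* vert (Ξ.d₀ e)
  /-- The edge inclusions at the terminal vertices. -/
  bdry₁ : ∀ e : E, edge e →ₜ* vert (Ξ.d₁ e)
  bdry₀_injective : ∀ e, Function.Injective (bdry₀ e)
  bdry₁_injective : ∀ e, Function.Injective (bdry₁ e)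

namespace GraphOfProfiniteGroups

variable {V : Type v} {E : Type x} {Ξ : FiniteGraph V E} (𝒢 : GraphOfProfiniteGroups.{u} Ξ)

/-- `W = (∐ v, 𝒢(v)) ⨿ F(T)`, where `F(T)` is the free profinite group on the stable letters
`T = {t_e : e ∈ E}`. -/
def W : ProfiniteGrp.{max v u x} :=
  BinaryFreeProfiniteProduct (FreeProfiniteProduct 𝒢.vert) (FreeProfiniteGroup E)

/-- The canonical homomorphism `𝒢(a) → W`. -/
def vertToW (a : V) : 𝒢.vert a →* 𝒢.W :=
  (BinaryFreeProfiniteProduct.inl _ _).comp (FreeProfiniteProduct.of 𝒢.vert a)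

/-- The stable letter `t_e` in `W`. -/
def stableLetter (e : E) : 𝒢.W :=
  BinaryFreeProfiniteProduct.inr _ _ (FreeProfiniteGroup.of e)

/-- The relators: `t_e` for the edges `e` of the spanning tree, and `∂₁(g) t_e⁻¹ ∂₀(g)⁻¹ t_e` for
every edge `e` and every `g ∈ 𝒢(e)`. -/
def relators (Θ : Set E) : Set 𝒢.W :=
  {r | ∃ e ∈ Θ, r = 𝒢.stableLetter e} ∪
  {r | ∃ (e : E) (g : 𝒢.edge e),
    r = 𝒢.vertToW (Ξ.d₁ e) (𝒢.bdry₁ e g) * (𝒢.stableLetter e)⁻¹ *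
      (𝒢.vertToW (Ξ.d₀ e) (𝒢.bdry₀ e g))⁻¹ * 𝒢.stableLetter e}

/-- The smallest closed normal subgroup of `W` containing the relators. -/
def N (Θ : Set E) : Subgroup 𝒢.W :=
  (Subgroup.normalClosure (𝒢.relators Θ)).topologicalClosure

instance normal_N (Θ : Set E) : (𝒢.N Θ).Normal :=
  Subgroup.is_normal_topologicalClosure _

/-- The profinite fundamental group `Π₁(𝒢, Ξ, Θ) = W ⧸ N`, with the quotient topology. -/
abbrev FundamentalGroup (Θ : Set E) : Type (max v u x) :=
  𝒢.W ⧸ 𝒢.N Θ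

/-- The canonical homomorphism `𝒢(a) → Π₁(𝒢, Ξ, Θ)`. -/
def vertToFundamentalGroup (Θ : Set E) (a : V) : 𝒢.vert a →* 𝒢.FundamentalGroup Θ :=
  (QuotientGroup.mk' (𝒢.N Θ)).comp (𝒢.vertToW a)

/-- Given an identification `φ` of the profinite fundamental group with `G`, the subgroup of `G`
which is the image of the vertex group `𝒢(a)`. -/
def vertexSubgroup {Θ : Set E} {G : Type*} [Group G] [TopologicalSpace G]
    (φ : 𝒢.FundamentalGroup Θ ≃ₜ* G) (a : V) : Subgroup G :=
  (𝒢.vertToFundamentalGroup Θ a).range.map φ.toMulEquiv.toMonoidHom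

end GraphOfProfiniteGroups

/-- A profinite group is strongly complete if all its normal subgroups of finite index are
open. -/
def IsStronglyComplete (A : Type*) [Group A] [TopologicalSpace A] : Prop :=
  ∀ N : Subgroup A, N.Normal → N.FiniteIndex → IsOpen (N : Set A)

/-- The closed subgroup `H` is accessible within the profinite group `G` via the graph of
profinite groups `(𝒢, Ξ, Θ)`, where `Θ` is a spanning tree of `Ξ` and `φ` is the identification
`G = Π₁(𝒢, Ξ, Θ)`: the group `H` is one of the vertex groups, the edge groups are finite and the
vertex groups are strongly complete. -/
structure IsAccessibleVia {V : Type v} {E : Type x} {Ξ : FiniteGraph V E}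
    (𝒢 : GraphOfProfiniteGroups.{u} Ξ) (Θ : Set E) {G : Type*} [Group G] [TopologicalSpace G]
    (φ : 𝒢.FundamentalGroup Θ ≃ₜ* G) (H : Subgroup G) : Prop where
  isClosed : IsClosed (H : Set G)
  isSpanningTree : Ξ.IsSpanningTree Θ
  exists_vertex : ∃ a : V, 𝒢.vertexSubgroup φ a = H
  finite_edge : ∀ e : E, Finite (𝒢.edge e)
  stronglyComplete_vert : ∀ a : V, IsStronglyComplete (𝒢.vert a)

/-! ### The completed group algebra and derivations -/

section CompletedGroupAlgebra

variable (R : Type*) [Ring R] (G : Type*) [Group G] [TopologicalSpace G]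

/-- The completed group algebra `R[[G]]`: the inverse limit of the group algebras `R[G ⧸ U]` over
the open normal subgroups `U` of `G`. -/
def CompletedGroupAlgebra : Subring (∀ U : OpenNormalSubgroup G, MonoidAlgebra R (G ⧸ U.toSubgroup))
    where
  carrier := {s | ∀ (U U' : OpenNormalSubgroup G) (h : U.toSubgroup ≤ U'.toSubgroup),
    MonoidAlgebra.mapDomainRingHom R
      (QuotientGroup.map U.toSubgroup U'.toSubgroup (MonoidHom.id G) h) (s U) = s U'}
  mul_mem' ha hb U U' h := by simp only [Pi.mul_apply, map_mul, ha U U' h, hb U U' h]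
  one_mem' U U' h := by simp only [Pi.one_apply, map_one]
  add_mem' ha hb U U' h := by simp only [Pi.add_apply, map_add, ha U U' h, hb U U' h]
  zero_mem' U U' h := by simp only [Pi.zero_apply, map_zero]
  neg_mem' ha U U' h := by simp only [Pi.neg_apply, map_neg, ha U U' h]

/-- The inverse limit topology, where `R[G ⧸ U]` carries the topology of pointwise convergence of
coefficients, i.e. the product topology of copies of `R` when `G ⧸ U` is finite. -/
instance CompletedGroupAlgebra.instTopologicalSpace [TopologicalSpace R] :
    TopologicalSpace (CompletedGroupAlgebra R G) :=
  TopologicalSpace.induced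
    (fun s => fun (U : OpenNormalSubgroup G) (q : G ⧸ U.toSubgroup) => (s.1 U).coeff q)
    inferInstance

/-- The canonical map `G → R[[G]]`. -/
def CompletedGroupAlgebra.of : G →* CompletedGroupAlgebra R G where
  toFun g := ⟨fun U => MonoidAlgebra.of R _ (QuotientGroup.mk g), fun U U' h => by
    simp only [MonoidAlgebra.of_apply, MonoidAlgebra.mapDomainRingHom_apply,
      MonoidAlgebra.mapDomain_single]
    rfl⟩
  map_one' := Subtype.ext (funext fun U => map_one (MonoidAlgebra.of R _))
  map_mul' g h := Subtype.ext (funext fun U =>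
    map_mul (MonoidAlgebra.of R (G ⧸ U.toSubgroup)) (QuotientGroup.mk g) (QuotientGroup.mk h))

variable {R G} in
/-- Right derivations of `G` in the right `G`-module `R[[G]]`: `f (g h) = f(g) h + f(h)`. -/
def IsRightDerivation (f : G → CompletedGroupAlgebra R G) : Prop :=
  ∀ g h : G, f (g * h) = f g * CompletedGroupAlgebra.of R G h + f h

end CompletedGroupAlgebra

end

/-! On a vertex group any element `m a` of `R[[G]]` gives the inner derivation g ↦ m_a(g - 1). The
proof chooses the `m a` so that these glue to a derivation of `G` vanishing on `H = G(b)`, while on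
`G(w)` it vanishes only on elements of `H`.

For w = b the zero map works. Otherwise some tree edge e₀ at b separates b from w. Let K be the
finite image in `G` of its edge group and n ∈ `R[[G]]` the sum of the elements of K. Put m_a = 0 on
the side of b and m_a = n on the other side. Since nk = n for k ∈ K, the two choices agree on the
edge group of e₀; along other tree edges m is constant, and for an edge outside the tree the value
on the stable letter is free and absorbs the discrepancy. The result vanishes on `G(b)`, and on
`G(w)` it is g ↦ n(g - 1), whose zeros lie in K (`mem_of_finsetSum_mul`). As e₀ touches b, K ≤
`G(b)`.

Gluing (`exists_derivation`) uses that a derivation is a homomorphic section of the profinite group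
`R[[G]]` ⋊ `G` over `G`, so the universal property of `W` applies (`exists_lift_W`). -/

noncomputable section

/-! ### Extension of homomorphisms to completions -/

section Extension

variable {A K P : Type*} [Group A] [Group K] [TopologicalSpace K] [IsTopologicalGroup K]
  [Group P] [TopologicalSpace P] [IsTopologicalGroup P] [CompactSpace P]
  [TotallyDisconnectedSpace P]

/-- In a profinite group an element lying in all open normal subgroups is trivial. -/
theorem eq_one_of_forall_mem_openNormalSubgroup {p : P}
    (h : ∀ U : OpenNormalSubgroup P, p ∈ U.toSubgroup) : p = 1 := by
  by_contra hp
  obtain ⟨U, hU⟩ := ProfiniteGrp.exist_openNormalSubgroup_sub_open_nhds_of_one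
    (isOpen_compl_singleton (x := p)) (by simpa using Ne.symm hp)
  exact hU (h U) rfl

/-- A homomorphism into a profinite group extends along a homomorphism with dense range, if the
preimages of the open normal subgroups are open in the induced topology. -/
theorem exists_continuousMonoidHom_extending (j : A →* K) (hj : DenseRange j) (ψ : A →* P)
    (h : ∀ U : OpenNormalSubgroup P, ∃ O : Set K, IsOpen O ∧ 1 ∈ O ∧
      ∀ a, j a ∈ O → ψ a ∈ U.toSubgroup) :
    ∃ F : K →ₜ* P, ∀ a, F (j a) = ψ a := by
  -- The closure of the set of pairs (j a, ψ a) is the graph of the extension: the hypothesis on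
  -- open normal subgroups makes it single-valued, and compactness of `P` makes its projection to
  -- `K` closed, hence onto.
  set Γ : Subgroup (K × P) := (j.prod ψ).range.topologicalClosure with hΓ
  have hmem (a : A) : (j a, ψ a) ∈ Γ := Subgroup.le_topologicalClosure _ ⟨a, rfl⟩
  have hone (p : P) (hp : ((1 : K), p) ∈ Γ) : p = 1 := by
    refine eq_one_of_forall_mem_openNormalSubgroup fun U => ?_
    obtain ⟨O, hO, h1, hOU⟩ := h U
    have hopen : IsOpen {q : P | p⁻¹ * q ∈ U.toSubgroup} :=
      U.isOpen'.preimage (continuous_const_mul p⁻¹)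
    obtain ⟨_, ⟨hyO, hyU⟩, a, rfl⟩ := mem_closure_iff.1 hp _ (hO.prod hopen)
      ⟨h1, by simp⟩
    have := U.toSubgroup.mul_mem (hOU a hyO) (U.toSubgroup.inv_mem hyU)
    simpa using this
  have huniq (k : K) (p q : P) (hp : (k, p) ∈ Γ) (hq : (k, q) ∈ Γ) : p = q := by
    have := hone (p⁻¹ * q) (by simpa using Γ.mul_mem (Γ.inv_mem hp) hq)
    exact inv_mul_eq_one.1 this
  have hΓc : IsClosed (Γ : Set (K × P)) := Subgroup.isClosed_topologicalClosure _
  have hex (k : K) : ∃ p, (k, p) ∈ Γ := by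
    have hcl : IsClosed (Prod.fst '' (Γ : Set (K × P))) :=
      isClosedMap_fst_of_compactSpace _ hΓc
    have hk : k ∈ Prod.fst '' (Γ : Set (K × P)) := by
      refine closure_minimal ?_ hcl (hj k)
      rintro _ ⟨a, rfl⟩
      exact ⟨_, hmem a, rfl⟩
    obtain ⟨⟨_, p⟩, hp, rfl⟩ := hk
    exact ⟨p, hp⟩
  choose F hF using hex
  refine ⟨⟨⟨⟨F, huniq _ _ _ (hF 1) Γ.one_mem⟩, fun k l => huniq _ _ _ (hF _)
    (by simpa using Γ.mul_mem (hF k) (hF l))⟩, ?_⟩, fun a => huniq _ _ _ (hF _) (hmem a)⟩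
  refine continuous_iff_isClosed.2 fun C hC => ?_
  have : F ⁻¹' C = Prod.fst '' ((Γ : Set (K × P)) ∩ Prod.snd ⁻¹' C) := by
    ext k
    constructor
    · exact fun hk => ⟨(k, F k), ⟨hF k, hk⟩, rfl⟩
    · rintro ⟨⟨_, p⟩, ⟨hp, hpC⟩, rfl⟩
      have := huniq _ _ _ hp (hF _)
      subst this
      exact hpC
  change IsClosed (F ⁻¹' C)
  rw [this]
  exact isClosedMap_fst_of_compactSpace _ (hΓc.inter (hC.preimage continuous_snd))

end Extension

namespace relCompletion

variable {A : Type u} [Group A] {𝒩 : Set (FiniteIndexNormalSubgroup A)}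

/-- The kernels of the projections of the completion are open. -/
theorem isOpen_ker_proj (N : FiniteIndexNormalSubgroup A) (hN : N ∈ 𝒩) :
    IsOpen {z : relCompletion A 𝒩 | z.1 ⟨N, hN⟩ = 1} := by
  have hc : Continuous fun z : relCompletion A 𝒩 => z.1 ⟨N, hN⟩ :=
    (continuous_apply _).comp continuous_subtype_val
  have hd : DiscreteTopology (((Subtype.mono_coe (· ∈ 𝒩)).functor ⋙
      ProfiniteGrp.ProfiniteCompletion.diagram (GrpCat.of A)).obj ⟨N, hN⟩) := ⟨rfl⟩
  exact (isOpen_discrete {1}).preimage hc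

/-- Each coordinate factors through the quotient of `B` by an open subgroup, which is discrete. -/
theorem continuous_of_comp {B : Type*} [Group B] [TopologicalSpace B] [IsTopologicalGroup B]
    (f : B →* A) (hf : ∀ N ∈ 𝒩, IsOpen (N.toSubgroup.comap f : Set B)) :
    Continuous ((relCompletion.of A 𝒩).comp f) := by
  refine Continuous.subtype_mk (continuous_pi fun N => ?_) _
  obtain ⟨N, hN⟩ := N
  have : Continuous (QuotientGroup.mk : B → B ⧸ N.toSubgroup.comap f) := continuous_quotient_mk'
  have hd : DiscreteTopology (B ⧸ N.toSubgroup.comap f) :=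
    QuotientGroup.discreteTopology (hf N hN)
  let q : B ⧸ N.toSubgroup.comap f → A ⧸ N.toSubgroup :=
    QuotientGroup.map _ _ f le_rfl
  let _ : TopologicalSpace (A ⧸ N.toSubgroup) := ⊥
  exact (continuous_of_discreteTopology (f := q)).comp this

theorem denseRange_of (htop : ∃ N, N ∈ 𝒩) (hinf : ∀ M ∈ 𝒩, ∀ N ∈ 𝒩, M ⊓ N ∈ 𝒩) :
    DenseRange (relCompletion.of A 𝒩) := by
  classical
  refine dense_iff_inter_open.mpr ?_
  rintro U ⟨s, hsO, rfl⟩ ⟨z, hz⟩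
  obtain ⟨J, O, hJ, hJs⟩ := isOpen_pi_iff.mp hsO _ hz
  -- A basic open set constrains finitely many coordinates; closure under intersection gives one
  -- level dominating all of them, and there every coordinate comes from `A`.
  have hlow : ∃ M : {N // N ∈ 𝒩}, ∀ N ∈ J, M ≤ N := by
    clear hJ hJs
    induction J using Finset.induction_on with
    | empty => exact ⟨⟨_, htop.choose_spec⟩, by simp⟩
    | insert N J _ ih =>
      obtain ⟨M, hM⟩ := ih
      refine ⟨⟨_, hinf _ M.2 _ N.2⟩, fun N' hN' => ?_⟩
      rcases Finset.mem_insert.1 hN' with rfl | h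
      · exact inf_le_right (a := M.1)
      · exact (inf_le_left (a := M.1) (b := N.1)).trans (hM N' h)
  obtain ⟨M, hM⟩ := hlow
  obtain ⟨a, ha⟩ := QuotientGroup.mk'_surjective M.1.toSubgroup (z.1 M)
  refine ⟨relCompletion.of A 𝒩 a, hJs fun N hN => ?_, a, rfl⟩
  have h1 := z.2 (homOfLE (hM N hN))
  have h2 := (relCompletion.of A 𝒩 a).2 (homOfLE (hM N hN))
  have h3 : (relCompletion.of A 𝒩 a).1 M = z.1 M := ha
  have h4 : (relCompletion.of A 𝒩 a).1 N = z.1 N := by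
    rw [← h1, ← h2, h3]
  rw [h4]
  exact (hJ N hN).2

/-- The universal property of the completion with respect to `𝒩`. -/
theorem exists_lift {P : Type*} [Group P] [TopologicalSpace P] [IsTopologicalGroup P]
    [CompactSpace P] [TotallyDisconnectedSpace P]
    (hinf : ∀ M ∈ 𝒩, ∀ N ∈ 𝒩, M ⊓ N ∈ 𝒩) (ψ : A →* P)
    (hψ : ∀ U : OpenNormalSubgroup P, U.toFiniteIndexNormalSubgroup.comap ψ ∈ 𝒩) :
    ∃ F : relCompletion A 𝒩 →ₜ* P, ∀ a, F (relCompletion.of A 𝒩 a) = ψ a := by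
  obtain ⟨U⟩ : Nonempty (OpenNormalSubgroup P) :=
    ⟨⟨⟨⊤, isOpen_univ⟩, inferInstanceAs (⊤ : Subgroup P).Normal⟩⟩
  refine exists_continuousMonoidHom_extending _ (denseRange_of ⟨_, hψ U⟩ hinf) ψ fun U =>
    ⟨_, isOpen_ker_proj _ (hψ U), rfl, fun a ha => ?_⟩
  exact (QuotientGroup.eq_one_iff a).1 ha

end relCompletion

/-! ### Universal properties of free profinite products -/

namespace FreeProfiniteProduct

variable {ι : Type v} (A : ι → ProfiniteGrp.{u})

/-- The normal subgroups of finite index of the abstract free product which meet every factor in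
an open subgroup. -/
def index : Set (FiniteIndexNormalSubgroup (Monoid.CoprodI fun i => A i)) :=
  {N | ∀ i, IsOpen ((N.toSubgroup.comap (Monoid.CoprodI.of (i := i))) : Set (A i))}

theorem inf_mem_index : ∀ M ∈ index A, ∀ N ∈ index A, M ⊓ N ∈ index A :=
  fun _ hM _ hN i => (hM i).inter (hN i)

theorem continuous_of (i : ι) : Continuous (of A i) :=
  relCompletion.continuous_of_comp _ fun _ hN => hN i

variable {P : Type*} [Group P] [TopologicalSpace P]

theorem exists_lift [IsTopologicalGroup P] [CompactSpace P] [TotallyDisconnectedSpace P]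
    (f : ∀ i, A i →ₜ* P) : ∃ F : FreeProfiniteProduct A →ₜ* P, ∀ i a, F (of A i a) = f i a := by
  obtain ⟨F, hF⟩ := relCompletion.exists_lift (inf_mem_index A)
    (Monoid.CoprodI.lift fun i => (f i : A i →* P)) fun U i => by
      convert U.isOpen'.preimage (f i).continuous_toFun using 1
      ext a
      simp [FiniteIndexNormalSubgroup.comap]
      rfl
  exact ⟨F, fun i a => (hF _).trans (Monoid.CoprodI.lift_of _ _)⟩

theorem hom_ext [T2Space P] {f g : FreeProfiniteProduct A →ₜ* P}
    (h : ∀ i a, f (of A i a) = g (of A i a)) (z : FreeProfiniteProduct A) : f z = g z := by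
  have hd := relCompletion.denseRange_of (𝒩 := index A)
    ⟨FiniteIndexNormalSubgroup.ofSubgroup ⊤, fun i => isOpen_univ⟩ (inf_mem_index A)
  refine congrFun (hd.equalizer f.continuous_toFun g.continuous_toFun (funext fun a => ?_)) z
  refine DFunLike.congr_fun (f := f.toMonoidHom.comp (relCompletion.of _ _))
    (g := g.toMonoidHom.comp (relCompletion.of _ _)) ?_ a
  exact Monoid.CoprodI.ext_hom _ _ fun i => MonoidHom.ext fun a => h i a

end FreeProfiniteProduct

namespace BinaryFreeProfiniteProduct

variable (A : ProfiniteGrp.{u}) (B : ProfiniteGrp.{v})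

/-- The normal subgroups of finite index of the abstract free product which meet both factors in
open subgroups. -/
def index : Set (FiniteIndexNormalSubgroup (Monoid.Coprod A B)) :=
  {N | IsOpen ((N.toSubgroup.comap Monoid.Coprod.inl) : Set A) ∧
    IsOpen ((N.toSubgroup.comap Monoid.Coprod.inr) : Set B)}

theorem inf_mem_index : ∀ M ∈ index A B, ∀ N ∈ index A B, M ⊓ N ∈ index A B :=
  fun _ hM _ hN => ⟨hM.1.inter hN.1, hM.2.inter hN.2⟩

theorem continuous_inl : Continuous (inl A B) :=
  relCompletion.continuous_of_comp _ fun _ hN => hN.1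

theorem continuous_inr : Continuous (inr A B) :=
  relCompletion.continuous_of_comp _ fun _ hN => hN.2

variable {P : Type*} [Group P] [TopologicalSpace P]

theorem exists_lift [IsTopologicalGroup P] [CompactSpace P] [TotallyDisconnectedSpace P]
    (f : A →ₜ* P) (g : B →ₜ* P) : ∃ F : BinaryFreeProfiniteProduct A B →ₜ* P,
      (∀ a, F (inl A B a) = f a) ∧ ∀ b, F (inr A B b) = g b := by
  obtain ⟨F, hF⟩ := relCompletion.exists_lift (inf_mem_index A B)
    (Monoid.Coprod.lift (f : A →* P) (g : B →* P)) fun U => by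
      constructor
      · convert U.isOpen'.preimage f.continuous_toFun using 1
        ext a
        simp [FiniteIndexNormalSubgroup.comap]
        rfl
      · convert U.isOpen'.preimage g.continuous_toFun using 1
        ext a
        simp [FiniteIndexNormalSubgroup.comap]
        rfl
  exact ⟨F, fun a => (hF _).trans (Monoid.Coprod.lift_apply_inl _ _ _),
    fun b => (hF _).trans (Monoid.Coprod.lift_apply_inr _ _ _)⟩

theorem hom_ext [T2Space P] {f g : BinaryFreeProfiniteProduct A B →ₜ* P}
    (hl : ∀ a, f (inl A B a) = g (inl A B a)) (hr : ∀ b, f (inr A B b) = g (inr A B b))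
    (z : BinaryFreeProfiniteProduct A B) : f z = g z := by
  have hd := relCompletion.denseRange_of (𝒩 := index A B)
    ⟨FiniteIndexNormalSubgroup.ofSubgroup ⊤, isOpen_univ, isOpen_univ⟩ (inf_mem_index A B)
  refine congrFun (hd.equalizer f.continuous_toFun g.continuous_toFun (funext fun a => ?_)) z
  refine DFunLike.congr_fun (f := f.toMonoidHom.comp (relCompletion.of _ _))
    (g := g.toMonoidHom.comp (relCompletion.of _ _)) ?_ a
  exact Monoid.Coprod.hom_ext (MonoidHom.ext hl) (MonoidHom.ext hr)

end BinaryFreeProfiniteProduct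

namespace FreeProfiniteGroup

/-- The canonical homomorphism of the free group into the free profinite group. -/
def ofFreeGroup (T : Type x) : FreeGroup T →* FreeProfiniteGroup T :=
  (ProfiniteGrp.ProfiniteCompletion.eta (GrpCat.of (FreeGroup T))).hom

theorem denseRange_ofFreeGroup (T : Type x) : DenseRange (ofFreeGroup T) :=
  ProfiniteGrp.ProfiniteCompletion.denseRange _

variable {T : Type x} {P : Type*} [Group P] [TopologicalSpace P]

theorem exists_lift [IsTopologicalGroup P] [CompactSpace P] [TotallyDisconnectedSpace P]
    (f : T → P) : ∃ F : FreeProfiniteGroup T →ₜ* P, ∀ t, F (of t) = f t := by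
  obtain ⟨F, hF⟩ := exists_continuousMonoidHom_extending (ofFreeGroup T)
    (denseRange_ofFreeGroup T) (FreeGroup.lift f) fun U => by
      let N := U.toFiniteIndexNormalSubgroup.comap (FreeGroup.lift f)
      have hc : Continuous fun z : FreeProfiniteGroup T => z.1 N :=
        (continuous_apply _).comp continuous_subtype_val
      have hd : DiscreteTopology ((ProfiniteGrp.ProfiniteCompletion.diagram
        (GrpCat.of (FreeGroup T))).obj N) := ⟨rfl⟩
      exact ⟨_, (isOpen_discrete {1}).preimage hc, rfl, fun a ha =>
        (QuotientGroup.eq_one_iff (N := N.toSubgroup) a).1 ha⟩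
  exact ⟨F, fun t => (hF _).trans (FreeGroup.lift_apply_of ..)⟩

theorem hom_ext [T2Space P] {f g : FreeProfiniteGroup T →ₜ* P}
    (h : ∀ t, f (of t) = g (of t)) (z : FreeProfiniteGroup T) : f z = g z := by
  refine congrFun ((denseRange_ofFreeGroup T).equalizer
    f.continuous_toFun g.continuous_toFun (funext fun a => ?_)) z
  refine DFunLike.congr_fun (f := f.toMonoidHom.comp (ofFreeGroup T))
    (g := g.toMonoidHom.comp (ofFreeGroup T)) ?_ a
  exact FreeGroup.ext_hom _ _ h

end FreeProfiniteGroup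

namespace GraphOfProfiniteGroups

variable {V : Type v} {E : Type x} {Ξ : FiniteGraph V E} (𝒢 : GraphOfProfiniteGroups.{u} Ξ)

theorem continuous_vertToW (a : V) : Continuous (𝒢.vertToW a) :=
  (BinaryFreeProfiniteProduct.continuous_inl _ _).comp (FreeProfiniteProduct.continuous_of _ a)

variable {P : Type*} [Group P] [TopologicalSpace P]

theorem exists_lift_W [IsTopologicalGroup P] [CompactSpace P] [TotallyDisconnectedSpace P]
    (f : ∀ a, 𝒢.vert a →ₜ* P)
    (t : E → P) : ∃ F : 𝒢.W →ₜ* P, (∀ a g, F (𝒢.vertToW a g) = f a g) ∧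
      ∀ e, F (𝒢.stableLetter e) = t e := by
  obtain ⟨F₁, h₁⟩ := FreeProfiniteProduct.exists_lift 𝒢.vert f
  obtain ⟨F₂, h₂⟩ := FreeProfiniteGroup.exists_lift t
  obtain ⟨F, hl, hr⟩ := BinaryFreeProfiniteProduct.exists_lift _ _ F₁ F₂
  exact ⟨F, fun a g => (hl _).trans (h₁ a g), fun e => (hr _).trans (h₂ e)⟩

theorem hom_ext_W [T2Space P] {f g : 𝒢.W →ₜ* P}
    (hv : ∀ a y, f (𝒢.vertToW a y) = g (𝒢.vertToW a y))
    (ht : ∀ e, f (𝒢.stableLetter e) = g (𝒢.stableLetter e)) (z : 𝒢.W) : f z = g z :=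
  BinaryFreeProfiniteProduct.hom_ext _ _
    (FreeProfiniteProduct.hom_ext _
      (f := f.comp ⟨_, BinaryFreeProfiniteProduct.continuous_inl _ _⟩)
      (g := g.comp ⟨_, BinaryFreeProfiniteProduct.continuous_inl _ _⟩) hv)
    (FreeProfiniteGroup.hom_ext
      (f := f.comp ⟨_, BinaryFreeProfiniteProduct.continuous_inr _ _⟩)
      (g := g.comp ⟨_, BinaryFreeProfiniteProduct.continuous_inr _ _⟩) ht) z

end GraphOfProfiniteGroups

/-! ### The completed group algebra as a profinite module -/

namespace CompletedGroupAlgebra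

variable (R : Type*) [Ring R] (G : Type*) [Group G] [TopologicalSpace G]

/-- The family of coefficients of an element of `R[[G]]`. -/
def coeffs (s : CompletedGroupAlgebra R G) (U : OpenNormalSubgroup G) (q : G ⧸ U.toSubgroup) : R :=
  (s.1 U).coeff q

theorem coeffs_injective : Function.Injective (coeffs R G) := fun _ _ h =>
  Subtype.ext <| funext fun U => MonoidAlgebra.coeff_injective <|
    Finsupp.ext fun q => congrFun (congrFun h U) q

variable {R G}

theorem coeffs_mul_of (s : CompletedGroupAlgebra R G) (g : G) (U : OpenNormalSubgroup G)
    (q : G ⧸ U.toSubgroup) :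
    coeffs R G (s * of R G g) U q = coeffs R G s U (q * (QuotientGroup.mk g)⁻¹) := by
  refine (MonoidAlgebra.coeff_mul_single_eq_coeff_mul (r := (1 : R)) (q * (QuotientGroup.mk g)⁻¹)
    fun m _ => eq_mul_inv_iff_mul_eq.symm).trans (mul_one _)

variable [TopologicalSpace R]

theorem isEmbedding_coeffs : Topology.IsEmbedding (coeffs R G) := ⟨⟨rfl⟩, coeffs_injective R G⟩

theorem continuous_iff {X : Type*} [TopologicalSpace X] {f : X → CompletedGroupAlgebra R G} :
    Continuous f ↔ ∀ U q, Continuous fun y => coeffs R G (f y) U q := by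
  rw [isEmbedding_coeffs.continuous_iff, continuous_pi_iff]
  exact forall_congr' fun U => continuous_pi_iff

theorem continuous_coeffs (U : OpenNormalSubgroup G) (q : G ⧸ U.toSubgroup) :
    Continuous fun s : CompletedGroupAlgebra R G => coeffs R G s U q :=
  continuous_iff.1 continuous_id U q

instance [T2Space R] : T2Space (CompletedGroupAlgebra R G) := isEmbedding_coeffs.t2Space

instance [TotallyDisconnectedSpace R] : TotallyDisconnectedSpace (CompletedGroupAlgebra R G) :=
  ⟨isEmbedding_coeffs.isTotallyDisconnected (isTotallyDisconnected_of_totallyDisconnectedSpace _)⟩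

instance [IsTopologicalRing R] : IsTopologicalAddGroup (CompletedGroupAlgebra R G) where
  continuous_add := continuous_iff.2 fun U q =>
    ((continuous_coeffs U q).comp continuous_fst).add ((continuous_coeffs U q).comp continuous_snd)
  continuous_neg := continuous_iff.2 fun U q => (continuous_coeffs U q).neg

/-- At level `U` right multiplication by `g` only permutes coefficients, and it depends on `g`
through the discrete quotient by `U`; this yields joint continuity. -/
theorem continuous_mul_of [IsTopologicalGroup G] :
    Continuous fun p : CompletedGroupAlgebra R G × G => p.1 * of R G p.2 := by
  refine continuous_iff.2 fun U q => ?_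
  simp only [coeffs_mul_of]
  have hd : DiscreteTopology (G ⧸ U.toSubgroup) := QuotientGroup.discreteTopology U.isOpen'
  have hev : Continuous fun p : CompletedGroupAlgebra R G × (G ⧸ U.toSubgroup) =>
      coeffs R G p.1 U (q * p.2⁻¹) :=
    continuous_prod_of_discrete_right.2 fun b => continuous_coeffs U (q * b⁻¹)
  exact hev.comp (continuous_fst.prodMk (continuous_quotient_mk'.comp continuous_snd))

/-- The quotients are finite, so compatibility of the levels amounts to equations between finite
sums of coefficients, which are closed conditions. This gives compactness of `R[[G]]`. -/
theorem isClosed_range_coeffs [IsTopologicalRing R] [T2Space R] [IsTopologicalGroup G]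
    [CompactSpace G] : IsClosed (Set.range (coeffs R G)) := by
  classical
  have hfin (U : OpenNormalSubgroup G) : Fintype (G ⧸ U.toSubgroup) := Fintype.ofFinite _
  have key (s : ∀ U : OpenNormalSubgroup G, MonoidAlgebra R (G ⧸ U.toSubgroup))
      (U U' : OpenNormalSubgroup G) (h : U.toSubgroup ≤ U'.toSubgroup) :
      MonoidAlgebra.mapDomainRingHom R
        (QuotientGroup.map U.toSubgroup U'.toSubgroup (MonoidHom.id G) h) (s U) = s U' ↔
      ∀ q', (∑ q, if QuotientGroup.map U.toSubgroup U'.toSubgroup (MonoidHom.id G) h q = q'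
        then (s U).coeff q else 0) = (s U').coeff q' := by
    rw [← MonoidAlgebra.coeff_inj, Finsupp.ext_iff]
    refine forall_congr' fun q' => ?_
    rw [MonoidAlgebra.mapDomainRingHom_apply, MonoidAlgebra.coeff_mapDomain, Finsupp.mapDomain,
      Finsupp.sum_fintype _ _ (by simp), Finsupp.finsetSum_apply]
    simp [Finsupp.single_apply]
  have : Set.range (coeffs R G) = {c | ∀ (U U' : OpenNormalSubgroup G)
      (h : U.toSubgroup ≤ U'.toSubgroup) (q' : G ⧸ U'.toSubgroup),
      (∑ q, if QuotientGroup.map U.toSubgroup U'.toSubgroup (MonoidHom.id G) h q = q'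
        then c U q else 0) = c U' q'} := by
    ext c
    constructor
    · rintro ⟨s, rfl⟩ U U' h
      exact (key s.1 U U' h).1 (s.2 U U' h)
    · intro hc
      exact ⟨⟨fun U => ⟨Finsupp.equivFunOnFinite.symm (c U)⟩, fun U U' h =>
        (key (fun U => ⟨Finsupp.equivFunOnFinite.symm (c U)⟩) U U' h).2 (hc U U' h)⟩, rfl⟩
  rw [this]
  simp only [Set.ofPred_forall]
  refine isClosed_iInter fun U => isClosed_iInter fun U' => isClosed_iInter fun h =>
    isClosed_iInter fun q' => isClosed_eq (continuous_finsetSum _ fun q _ => ?_) (by fun_prop)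
  split_ifs <;> fun_prop

instance [IsTopologicalRing R] [T2Space R] [CompactSpace R] [IsTopologicalGroup G]
    [CompactSpace G] : CompactSpace (CompletedGroupAlgebra R G) :=
  (Topology.IsClosedEmbedding.mk isEmbedding_coeffs isClosed_range_coeffs).compactSpace

/-! ### Sums over finite subgroups and their stabilizers -/

section FinsetSum

variable (R : Type*) [Ring R] {G : Type*} [Group G] [TopologicalSpace G]

/-- The sum in `R[[G]]` of the elements of a finite subset of `G`. -/
def finsetSum (S : Finset G) : CompletedGroupAlgebra R G :=
  ∑ y ∈ S, of R G y

theorem coeffs_finsetSum [DecidableEq G] (S : Finset G) (U : OpenNormalSubgroup G)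
    [DecidableEq (G ⧸ U.toSubgroup)] (q : G ⧸ U.toSubgroup) :
    coeffs R G (finsetSum R S) U q = ∑ y ∈ S, if (QuotientGroup.mk y) = q then 1 else 0 := by
  let c : CompletedGroupAlgebra R G →+ R :=
    { toFun := fun s => coeffs R G s U q
      map_zero' := rfl
      map_add' := fun _ _ => rfl }
  refine (map_sum c _ _).trans (Finset.sum_congr rfl fun y _ => ?_)
  exact Finsupp.single_apply

/-- Right multiplication by an element of a finite subgroup fixes the sum of its elements. -/
theorem finsetSum_mul_of_mem (K : Subgroup G) (S : Finset G) (hS : ∀ y, y ∈ S ↔ y ∈ K) {g : G}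
    (hg : g ∈ K) : finsetSum R S * of R G g = finsetSum R S := by
  rw [finsetSum, Finset.sum_mul]
  simp only [← map_mul]
  refine Finset.sum_bijective (· * g) (Group.mulRight_bijective g) (fun y => ?_) fun _ _ => rfl
  rw [hS, hS, K.mul_mem_cancel_right hg]

/-- The elements of `G` which fix the sum of the elements of a finite subgroup by right
multiplication belong to the subgroup. -/
theorem mem_of_finsetSum_mul [Nontrivial R] [IsTopologicalGroup G] [CompactSpace G] [T2Space G]
    [TotallyDisconnectedSpace G] (K : Subgroup G) (S : Finset G) (hS : ∀ y, y ∈ S ↔ y ∈ K) {g : G}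
    (hg : finsetSum R S * of R G g = finsetSum R S) : g ∈ K := by
  classical
  by_contra hgK
  -- If g ∉ K, then 1 lies neither in K \ {1} nor in Kg. For `U` avoiding both, the coefficient of
  -- the sum at the trivial coset is exactly 1, while that of its translate is 0. Isolating the
  -- single term y = 1 makes the argument independent of the characteristic of `R`.
  let B : Set G := ((S.erase 1 ∪ S.image (· * g) : Finset G) : Set G)
  have h1 : (1 : G) ∈ Bᶜ := by
    simp only [B, Set.mem_compl_iff, Finset.coe_union, Set.mem_union, Finset.mem_coe,
      Finset.mem_erase, Finset.mem_image, not_or, not_exists, not_and]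
    refine ⟨fun h => absurd rfl h, fun y hy hyg => hgK ?_⟩
    rw [← inv_eq_of_mul_eq_one_right hyg]
    exact K.inv_mem ((hS y).1 hy)
  obtain ⟨U, hU⟩ := ProfiniteGrp.exist_openNormalSubgroup_sub_open_nhds_of_one
    (Finset.finite_toSet _).isClosed.isOpen_compl h1
  have hmk (y : G) : (QuotientGroup.mk y : G ⧸ U.toSubgroup) = 1 → y ∈ Bᶜ := fun h =>
    hU ((QuotientGroup.eq_one_iff y).1 h)
  have hc := congrArg (fun s => coeffs R G s U 1) hg
  simp only [coeffs_mul_of, coeffs_finsetSum] at hc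
  rw [Finset.sum_eq_zero, Finset.sum_eq_single_of_mem 1 ((hS 1).2 K.one_mem)] at hc
  · exact zero_ne_one (hc.trans (if_pos rfl))
  · refine fun y hy hy1 => if_neg fun h => hmk y h ?_
    exact Finset.mem_coe.2 (Finset.mem_union_left _ (Finset.mem_erase.2 ⟨hy1, hy⟩))
  · refine fun y hy => if_neg fun h => hmk (y * g) ?_ ?_
    · rw [QuotientGroup.mk_mul, h]
      simp
    · exact Finset.mem_coe.2 (Finset.mem_union_right _ (Finset.mem_image_of_mem _ hy))

end FinsetSum

end CompletedGroupAlgebra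

/-- Rewrites the edge relator without inverses, so that first components in `DerivationGroup` can be
compared directly. -/
theorem mul_inv_mul_inv_mul_eq_one_iff {Q : Type*} [Group Q] {a b t : Q} :
    a * t⁻¹ * b⁻¹ * t = 1 ↔ t * a = b * t := by
  rw [show a * t⁻¹ * b⁻¹ * t = a * (t⁻¹ * (b * t))⁻¹ by group, mul_inv_eq_one,
    eq_inv_mul_iff_mul_eq]

/-! ### Derivations as homomorphisms -/

/-- The set `R[[G]] × G` with the multiplication `(m, g) (n, h) = (m h + n, g h)`; a map
`f : G → R[[G]]` is a right derivation if and only if `g ↦ (f g, g)` is a homomorphism. -/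
def DerivationGroup (R : Type*) [Ring R] (G : Type*) [Group G] [TopologicalSpace G] : Type _ :=
  CompletedGroupAlgebra R G × G

namespace DerivationGroup

open CompletedGroupAlgebra (of)

variable {R : Type*} [Ring R] {G : Type*} [Group G] [TopologicalSpace G]

instance : Mul (DerivationGroup R G) := ⟨fun p q => (p.1 * of R G q.2 + q.1, p.2 * q.2)⟩

instance : One (DerivationGroup R G) := ⟨(0, 1)⟩

instance : Inv (DerivationGroup R G) := ⟨fun p => (-(p.1 * of R G p.2⁻¹), p.2⁻¹)⟩

theorem mul_fst (p q : DerivationGroup R G) : (p * q).1 = p.1 * of R G q.2 + q.1 := rfl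

theorem mul_snd (p q : DerivationGroup R G) : (p * q).2 = p.2 * q.2 := rfl

theorem one_fst : (1 : DerivationGroup R G).1 = 0 := rfl

theorem inv_fst (p : DerivationGroup R G) : (p⁻¹).1 = -(p.1 * of R G p.2⁻¹) := rfl

instance : Group (DerivationGroup R G) :=
  Group.ofLeftAxioms
    (fun p q r => Prod.ext
      (by simp only [mul_fst, mul_snd, map_mul, add_mul, mul_assoc, add_assoc]) (mul_assoc _ _ _))
    (fun p => Prod.ext (by simp only [mul_fst, one_fst, zero_mul, zero_add]) (one_mul _))
    (fun p => Prod.ext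
      (by simp only [mul_fst, one_fst, inv_fst, neg_mul, mul_assoc, ← map_mul, inv_mul_cancel,
            map_one, mul_one, neg_add_cancel])
      (inv_mul_cancel _))

variable [TopologicalSpace R]

instance : TopologicalSpace (DerivationGroup R G) :=
  inferInstanceAs (TopologicalSpace (CompletedGroupAlgebra R G × G))

instance [T2Space R] [T2Space G] : T2Space (DerivationGroup R G) :=
  inferInstanceAs (T2Space (CompletedGroupAlgebra R G × G))

instance [TotallyDisconnectedSpace R] [TotallyDisconnectedSpace G] :
    TotallyDisconnectedSpace (DerivationGroup R G) :=
  inferInstanceAs (TotallyDisconnectedSpace (CompletedGroupAlgebra R G × G))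

instance [IsTopologicalRing R] [T2Space R] [CompactSpace R] [IsTopologicalGroup G]
    [CompactSpace G] : CompactSpace (DerivationGroup R G) :=
  inferInstanceAs (CompactSpace (CompletedGroupAlgebra R G × G))

theorem continuous_fst : Continuous fun p : DerivationGroup R G => p.1 :=
  _root_.continuous_fst

theorem continuous_snd : Continuous fun p : DerivationGroup R G => p.2 :=
  _root_.continuous_snd

instance [IsTopologicalRing R] [IsTopologicalGroup G] :
    IsTopologicalGroup (DerivationGroup R G) where
  continuous_mul := by
    have h₁ := continuous_fst.comp
      (_root_.continuous_fst (X := DerivationGroup R G) (Y := DerivationGroup R G))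
    have h₂ := continuous_snd.comp
      (_root_.continuous_fst (X := DerivationGroup R G) (Y := DerivationGroup R G))
    have h₃ := continuous_fst.comp
      (_root_.continuous_snd (X := DerivationGroup R G) (Y := DerivationGroup R G))
    have h₄ := continuous_snd.comp
      (_root_.continuous_snd (X := DerivationGroup R G) (Y := DerivationGroup R G))
    exact ((CompletedGroupAlgebra.continuous_mul_of.comp (h₁.prodMk h₄)).add h₃).prodMk
      (h₂.mul h₄)
  continuous_inv :=
    (CompletedGroupAlgebra.continuous_mul_of.comp
      (continuous_fst.prodMk continuous_snd.inv)).neg.prodMk continuous_snd.inv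

/-- The projection to `G`. -/
def proj (R : Type*) [Ring R] [TopologicalSpace R] (G : Type*) [Group G] [TopologicalSpace G] :
    DerivationGroup R G →ₜ* G where
  toFun p := p.2
  map_one' := rfl
  map_mul' _ _ := rfl
  continuous_toFun := continuous_snd

/-- The homomorphism of a group over `G` given by the inner derivation `g ↦ m (g - 1)`. -/
def inner [IsTopologicalRing R] [IsTopologicalGroup G] {A : Type*} [Group A] [TopologicalSpace A]
    (f : A →ₜ* G) (m : CompletedGroupAlgebra R G) : A →ₜ* DerivationGroup R G where
  toFun a := (m * of R G (f a) - m, f a)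
  map_one' := Prod.ext (by simp [one_fst]) (map_one f)
  map_mul' a b := by
    refine Prod.ext ?_ (map_mul f a b)
    change m * of R G (f (a * b)) - m =
      (m * of R G (f a) - m) * of R G (f b) + (m * of R G (f b) - m)
    simp only [map_mul, sub_mul, mul_assoc]
    abel
  continuous_toFun := ((CompletedGroupAlgebra.continuous_mul_of.comp
    (continuous_const.prodMk f.continuous_toFun)).sub continuous_const).prodMk f.continuous_toFun

end DerivationGroup

/-! ### Gluing derivations over a graph of groups -/

namespace GraphOfProfiniteGroups

open CompletedGroupAlgebra (of)

variable {V : Type v} {E : Type x} {Ξ : FiniteGraph V E} (𝒢 : GraphOfProfiniteGroups.{u} Ξ)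
  {Θ : Set E} {G : Type*} [Group G] [TopologicalSpace G] (φ : 𝒢.FundamentalGroup Θ ≃ₜ* G)

/-- The canonical homomorphism `𝒢(a) → G`. -/
def vertTo (a : V) : 𝒢.vert a →ₜ* G where
  toMonoidHom := φ.toMulEquiv.toMonoidHom.comp (𝒢.vertToFundamentalGroup Θ a)
  continuous_toFun := φ.continuous.comp
    (continuous_quotient_mk'.comp (𝒢.continuous_vertToW a))

/-- The image in `G` of the stable letter `t_e`. -/
def stableLetterIn (e : E) : G := φ (QuotientGroup.mk (𝒢.stableLetter e))

theorem mem_vertexSubgroup {a : V} {g : G} :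
    g ∈ 𝒢.vertexSubgroup φ a ↔ ∃ y, 𝒢.vertTo φ a y = g := by
  constructor
  · rintro ⟨_, ⟨y, rfl⟩, rfl⟩
    exact ⟨y, rfl⟩
  · rintro ⟨y, rfl⟩
    exact ⟨_, ⟨y, rfl⟩, rfl⟩

theorem mk_relator {r : 𝒢.W} (hr : r ∈ 𝒢.relators Θ) :
    (QuotientGroup.mk r : 𝒢.FundamentalGroup Θ) = 1 :=
  (QuotientGroup.eq_one_iff r).2
    (Subgroup.le_topologicalClosure _ (Subgroup.subset_normalClosure hr))

theorem stableLetterIn_eq_one {e : E} (he : e ∈ Θ) : 𝒢.stableLetterIn φ e = 1 :=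
  (congrArg φ (𝒢.mk_relator (Or.inl ⟨e, he, rfl⟩))).trans (map_one φ)

theorem stableLetterIn_mul (e : E) (y : 𝒢.edge e) :
    𝒢.stableLetterIn φ e * 𝒢.vertTo φ (Ξ.d₁ e) (𝒢.bdry₁ e y) =
      𝒢.vertTo φ (Ξ.d₀ e) (𝒢.bdry₀ e y) * 𝒢.stableLetterIn φ e := by
  have h : 𝒢.vertTo φ (Ξ.d₁ e) (𝒢.bdry₁ e y) * (𝒢.stableLetterIn φ e)⁻¹ *
      (𝒢.vertTo φ (Ξ.d₀ e) (𝒢.bdry₀ e y))⁻¹ * 𝒢.stableLetterIn φ e = 1 := by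
    refine Eq.trans ?_ ((congrArg φ (𝒢.mk_relator (Or.inr ⟨e, y, rfl⟩))).trans (map_one φ))
    simp only [QuotientGroup.mk_mul, QuotientGroup.mk_inv, map_mul, map_inv]
    rfl
  exact mul_inv_mul_inv_mul_eq_one_iff.1 h

variable [IsTopologicalGroup G] [CompactSpace G] [T2Space G] [TotallyDisconnectedSpace G]
  {R : Type*} [Ring R] [TopologicalSpace R] [IsTopologicalRing R] [CompactSpace R] [T2Space R]
  [TotallyDisconnectedSpace R]

/-- Inner derivations on the vertex groups and values on the stable letters which are compatible
with the relators define a continuous derivation. -/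
theorem exists_derivation (m : V → CompletedGroupAlgebra R G) (c : E → CompletedGroupAlgebra R G)
    (htree : ∀ e ∈ Θ, c e = 0)
    (hedge : ∀ (e : E) (y : 𝒢.edge e),
      (c e + m (Ξ.d₁ e) - m (Ξ.d₀ e) * of R G (𝒢.stableLetterIn φ e)) *
        of R G (𝒢.vertTo φ (Ξ.d₁ e) (𝒢.bdry₁ e y)) =
      c e + m (Ξ.d₁ e) - m (Ξ.d₀ e) * of R G (𝒢.stableLetterIn φ e)) :
    ∃ f : G → CompletedGroupAlgebra R G, Continuous f ∧ IsRightDerivation f ∧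
      ∀ a y, f (𝒢.vertTo φ a y) = m a * of R G (𝒢.vertTo φ a y) - m a := by
  obtain ⟨F, hv, ht⟩ := 𝒢.exists_lift_W (P := DerivationGroup R G)
    (fun a => DerivationGroup.inner (𝒢.vertTo φ a) (m a))
    (fun e => (c e, 𝒢.stableLetterIn φ e))
  have hrel : 𝒢.relators Θ ⊆ F.toMonoidHom.ker := by
    rintro _ (⟨e, he, rfl⟩ | ⟨e, y, rfl⟩)
    · refine (ht e).trans (Prod.ext (htree e he) (𝒢.stableLetterIn_eq_one φ he))
    · have hcomm : F (𝒢.stableLetter e) * F (𝒢.vertToW (Ξ.d₁ e) (𝒢.bdry₁ e y)) =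
          F (𝒢.vertToW (Ξ.d₀ e) (𝒢.bdry₀ e y)) * F (𝒢.stableLetter e) := by
        rw [hv, hv, ht]
        refine Prod.ext ?_ (𝒢.stableLetterIn_mul φ e y)
        have h := hedge e y
        have h2 := congrArg (of R G) (𝒢.stableLetterIn_mul φ e y)
        simp only [map_mul] at h2
        -- Moving the stable letter past the edge element turns `hedge` into equality of the first
        -- components of the two products.
        simp only [sub_mul, add_mul, mul_assoc, h2] at h
        change c e * of R G (𝒢.vertTo φ (Ξ.d₁ e) (𝒢.bdry₁ e y)) +
            (m (Ξ.d₁ e) * of R G (𝒢.vertTo φ (Ξ.d₁ e) (𝒢.bdry₁ e y)) - m (Ξ.d₁ e)) =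
          (m (Ξ.d₀ e) * of R G (𝒢.vertTo φ (Ξ.d₀ e) (𝒢.bdry₀ e y)) - m (Ξ.d₀ e)) *
            of R G (𝒢.stableLetterIn φ e) + c e
        rw [sub_mul, mul_assoc]
        rw [sub_eq_iff_eq_add] at h
        rw [← add_sub_assoc, h]
        abel
      change F _ = 1
      rw [map_mul, map_mul, map_mul, map_inv, map_inv]
      exact mul_inv_mul_inv_mul_eq_one_iff.2 hcomm
  have hker : 𝒢.N Θ ≤ F.toMonoidHom.ker :=
    Subgroup.topologicalClosure_minimal _
      (Subgroup.normalClosure_le_normal hrel)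
      (isClosed_singleton.preimage F.continuous_toFun)
  let Fbar : 𝒢.FundamentalGroup Θ →* DerivationGroup R G :=
    QuotientGroup.lift _ F.toMonoidHom hker
  have hFbar : Continuous Fbar := continuous_quot_lift _ F.continuous_toFun
  -- Both maps from `W` to `G` agree on vertex groups and stable letters; hence the induced map on
  -- `G` is a section of the projection, which makes its first component a derivation.
  have hproj (z : 𝒢.W) : (F z).2 = φ (QuotientGroup.mk z) :=
    𝒢.hom_ext_W (f := (DerivationGroup.proj R G).comp F)
      (g := ⟨φ.toMulEquiv.toMonoidHom.comp (QuotientGroup.mk' (𝒢.N Θ)),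
        φ.continuous.comp continuous_quotient_mk'⟩)
      (fun a y => congrArg Prod.snd (hv a y)) (fun e => congrArg Prod.snd (ht e)) z
  have hsnd (g : G) : (Fbar (φ.symm g)).2 = g := by
    obtain ⟨z, hz⟩ := QuotientGroup.mk_surjective (φ.symm g)
    rw [← hz]
    refine (hproj z).trans ?_
    rw [hz, ContinuousMulEquiv.apply_symm_apply]
  refine ⟨fun g => (Fbar (φ.symm g)).1, DerivationGroup.continuous_fst.comp
    (hFbar.comp φ.symm.continuous), fun g h => ?_, fun a y => ?_⟩
  · change (Fbar (φ.symm (g * h))).1 = _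
    rw [map_mul, map_mul, DerivationGroup.mul_fst, hsnd]
  · have : φ.symm (𝒢.vertTo φ a y) = QuotientGroup.mk (𝒢.vertToW a y) := φ.symm_apply_apply _
    change (Fbar (φ.symm _)).1 = _
    rw [this]
    exact congrArg Prod.fst (hv a y)

end GraphOfProfiniteGroups

/-! ### Separation by an edge of a spanning tree -/

namespace FiniteGraph

variable {V : Type v} {E : Type x} {Ξ : FiniteGraph V E} {Θ : Set E}

theorem Joined.mono {S S' : Set E} (h : S ⊆ S') {a b : V} (hab : Ξ.Joined S a b) :
    Ξ.Joined S' a b :=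
  Relation.EqvGen.mono (fun _ _ ⟨e, he, h'⟩ => ⟨e, h he, h'⟩) _ _ hab

theorem joined_edge {S : Set E} {e : E} (he : e ∈ S) : Ξ.Joined S (Ξ.d₀ e) (Ξ.d₁ e) :=
  .rel _ _ ⟨e, he, rfl, rfl⟩

/-- A spanning tree has an edge at `b` whose removal separates `b` from a given other vertex. -/
theorem IsSpanningTree.exists_separating_edge (hΘ : Ξ.IsSpanningTree Θ) {b w : V} (hbw : w ≠ b) :
    ∃ e ∈ Θ, (Ξ.d₀ e = b ∨ Ξ.d₁ e = b) ∧ ¬ Ξ.Joined (Θ \ {e}) b w := by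
  -- `S` consists of the tree edges not touching b, and `Q` says that a vertex is b itself or is
  -- reached through a tree edge at b followed by a path in `S`. This is invariant along tree edges,
  -- so it holds at w and supplies the edge.
  let S : Set E := {e | e ∈ Θ ∧ Ξ.d₀ e ≠ b ∧ Ξ.d₁ e ≠ b}
  let Q : V → Prop := fun c => c = b ∨ ∃ e ∈ Θ,
    (Ξ.d₀ e = b ∧ Ξ.Joined S (Ξ.d₁ e) c) ∨ (Ξ.d₁ e = b ∧ Ξ.Joined S (Ξ.d₀ e) c)
  have hstep (e : E) (he : e ∈ Θ) : Q (Ξ.d₀ e) ↔ Q (Ξ.d₁ e) := by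
    by_cases h0 : Ξ.d₀ e = b
    · exact iff_of_true (Or.inl h0) (Or.inr ⟨e, he, Or.inl ⟨h0, .refl _⟩⟩)
    by_cases h1 : Ξ.d₁ e = b
    · exact iff_of_true (Or.inr ⟨e, he, Or.inr ⟨h1, .refl _⟩⟩) (Or.inl h1)
    have hj : Ξ.Joined S (Ξ.d₀ e) (Ξ.d₁ e) := joined_edge ⟨he, h0, h1⟩
    have hiff (a : V) : Ξ.Joined S a (Ξ.d₀ e) ↔ Ξ.Joined S a (Ξ.d₁ e) :=
      ⟨fun h => .trans _ _ _ h hj, fun h => .trans _ _ _ h (.symm _ _ hj)⟩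
    simp only [Q, h0, h1, false_or, hiff]
  have hQ (a c : V) (h : Ξ.Joined Θ a c) : Q a ↔ Q c := by
    induction h with
    | rel _ _ h =>
      obtain ⟨e, he, rfl, rfl⟩ := h
      exact hstep e he
    | refl => exact Iff.rfl
    | symm _ _ _ ih => exact ih.symm
    | trans _ _ _ _ _ ih₁ ih₂ => exact ih₁.trans ih₂
  rcases (hQ b w (hΘ.connected b w)).1 (Or.inl rfl) with h | ⟨e, he, h⟩
  · exact absurd h hbw
  have hSe : (Ξ.d₀ e = b ∨ Ξ.d₁ e = b) → S ⊆ Θ \ {e} := by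
    rintro hb e' ⟨he', h0, h1⟩
    refine ⟨he', ?_⟩
    rintro rfl
    exact hb.elim h0 h1
  -- A path from b to w avoiding e, closed up by the `S`-path between w and the far end of e, would
  -- join the endpoints of e without e.
  refine ⟨e, he, h.imp And.left And.left, fun hj => hΘ.acyclic e he ?_⟩
  rcases h with ⟨hb, h⟩ | ⟨hb, h⟩
  · have h' := h.mono (hSe (Or.inl hb))
    rw [hb]
    exact .trans _ _ _ hj (.symm _ _ h')
  · have h' := h.mono (hSe (Or.inr hb))
    rw [hb]
    exact .trans _ _ _ h' (.symm _ _ hj)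

end FiniteGraph

end

/-! ### The derivation attached to a separating edge -/

theorem mainTheorem4 {V : Type v} {E : Type x} {Ξ : FiniteGraph V E}
    (𝒢 : GraphOfProfiniteGroups.{u} Ξ) (Θ : Set E)
    {G : Type*} [Group G] [TopologicalSpace G] [IsTopologicalGroup G]
    [CompactSpace G] [T2Space G] [TotallyDisconnectedSpace G]
    (φ : 𝒢.FundamentalGroup Θ ≃ₜ* G) (H : Subgroup G)
    (hH : IsAccessibleVia 𝒢 Θ φ H)
    (R : Type*) [Ring R] [Nontrivial R] [TopologicalSpace R] [IsTopologicalRing R]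
    [CompactSpace R] [T2Space R] [TotallyDisconnectedSpace R]
    (w : V) :
    ∃ f : G → CompletedGroupAlgebra R G, Continuous f ∧ IsRightDerivation f ∧
      (𝒢.vertexSubgroup φ w : Set G) ∩ {g | f g = 0} = (𝒢.vertexSubgroup φ w : Set G) ∩ H := by
  classical
  obtain ⟨b, rfl⟩ := hH.exists_vertex
  have hΘ := hH.isSpanningTree
  by_cases hbw : w = b
  · subst hbw
    exact ⟨fun _ => 0, continuous_const, fun _ _ => by simp, by ext; simp⟩
  obtain ⟨e₀, he₀, hb, hsep⟩ := hΘ.exists_separating_edge hbw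
  have htree (e : E) (he : e ∈ Θ) (y : 𝒢.edge e) : 𝒢.vertTo φ (Ξ.d₁ e) (𝒢.bdry₁ e y) =
      𝒢.vertTo φ (Ξ.d₀ e) (𝒢.bdry₀ e y) := by
    simpa [𝒢.stableLetterIn_eq_one φ he] using 𝒢.stableLetterIn_mul φ e y
  let K : Subgroup G :=
    ((𝒢.vertTo φ (Ξ.d₁ e₀)).toMonoidHom.comp (𝒢.bdry₁ e₀).toMonoidHom).range
  have := hH.finite_edge e₀
  have hKfin : (K : Set G).Finite := Set.finite_range _
  have hS (y : G) : y ∈ hKfin.toFinset ↔ y ∈ K := hKfin.mem_toFinset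
  -- The stable letter of a tree edge is trivial in `G`, so both boundary maps of e₀ have the same
  -- image, whichever endpoint is b.
  have hKb : K ≤ 𝒢.vertexSubgroup φ b := by
    rintro _ ⟨y, rfl⟩
    rw [𝒢.mem_vertexSubgroup]
    rcases hb with rfl | rfl
    · exact ⟨_, (htree e₀ he₀ y).symm⟩
    · exact ⟨_, rfl⟩
  let n : CompletedGroupAlgebra R G := CompletedGroupAlgebra.finsetSum R hKfin.toFinset
  let m : V → CompletedGroupAlgebra R G := fun a => if Ξ.Joined (Θ \ {e₀}) b a then 0 else n
  have hm (e : E) (he : e ∈ Θ) (hne : e ≠ e₀) : m (Ξ.d₀ e) = m (Ξ.d₁ e) := by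
    have hj : Ξ.Joined (Θ \ {e₀}) (Ξ.d₀ e) (Ξ.d₁ e) := FiniteGraph.joined_edge ⟨he, hne⟩
    refine if_congr ?_ rfl rfl
    exact ⟨fun h => .trans _ _ _ h hj, fun h => .trans _ _ _ h (.symm _ _ hj)⟩
  have hmK (a : V) (k : G) (hk : k ∈ K) : m a * CompletedGroupAlgebra.of R G k = m a := by
    by_cases h : Ξ.Joined (Θ \ {e₀}) b a
    · simp [m, h]
    · simpa [m, h] using CompletedGroupAlgebra.finsetSum_mul_of_mem R K _ hS hk
  obtain ⟨f, hf, hder, hfv⟩ := 𝒢.exists_derivation φ m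
    -- Off the tree the value is chosen to make the bracket in `hedge` zero. For e₀ the bracket is a
    -- difference of elements fixed by K; for the other tree edges it vanishes because m is constant
    -- along them.
    (fun e => if e ∈ Θ then 0 else
      m (Ξ.d₀ e) * CompletedGroupAlgebra.of R G (𝒢.stableLetterIn φ e) - m (Ξ.d₁ e))
    (fun e he => if_pos he) (fun e y => by
      by_cases he : e ∈ Θ
      · by_cases hne : e = e₀
        · subst hne
          have hk : 𝒢.vertTo φ (Ξ.d₁ e) (𝒢.bdry₁ e y) ∈ K := ⟨y, rfl⟩
          simp [he, 𝒢.stableLetterIn_eq_one φ he, sub_mul, hmK _ _ hk]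
        · simp [he, 𝒢.stableLetterIn_eq_one φ he, hm e he hne]
      · simp [he])
  refine ⟨f, hf, hder, ?_⟩
  ext g
  -- On `G(w)` the equation f(g) = 0 reads ng = n, forcing g ∈ K ≤ `G(b)`; conversely f vanishes on
  -- all of `G(b)` because m_b = 0.
  refine and_congr_right fun hg => ⟨fun h0 => ?_, fun hgb => ?_⟩
  · obtain ⟨y, rfl⟩ := (𝒢.mem_vertexSubgroup φ).1 hg
    have h := hfv w y
    rw [show f _ = 0 from h0, show m w = n from if_neg hsep] at h
    exact hKb (CompletedGroupAlgebra.mem_of_finsetSum_mul R K _ hS (sub_eq_zero.1 h.symm))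
  · obtain ⟨y, rfl⟩ := (𝒢.mem_vertexSubgroup φ).1 hgb
    change f _ = 0
    rw [hfv, show m b = 0 from if_pos (.refl _)]
    simp
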